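/- \textbf{Corollary (Modified put-call parity).} Let $d\ge 1$, $T\ge 0$, let $W=(W_1,\dots,W_K)$ be a $K$-dimensional Brownian motion (with independent components) on $[0,T]$ with respect to a filtration $(\mathcal F(u))_{0\le u\le T}$ on a probability space with expectation $\mathbb E$, and let $\mu:[0,T]\times\mathbb R_+^d\to\mathbb R^d$ and $\sigma:[0,T]\times\mathbb R_+^d\to\mathbb R^{d\times K}$ be measurable, where $\mathbb R_+^d=(0,\infty)^d$. Fix $(t,s)\in[0,T]\times\mathbb R^d_+$ and let $S=S^{t,s}$ be an adapted, almost surely continuous and $\mathbb R^d_+$-valued process on $[t,T]$ with $S(t)=s$ and $$dS_i(u)=S_i(u)\Big(\mu_i(u,S(u))\,du+\sum_{k=1}^K\sigma_{i,k}(u,S(u))\,dW_k(u)\Big),\qquad i=1,\dots,d,$$ such that $\sum_{i=1}^d\int_t^T\big(|\mu_i(u,S(u))|+(\sigma\sigma^{\mathsf T})_{i,i}(u,S(u))\big)du<\infty$ almost surely. Let $\theta:[0,T]\times\mathbb R_+^d\to\mathbb R^K$ be a Markovian square-integrable market price of risk, that is, a measurable function such that, almost surely, $\mu(u,S(u))=\sigma(u,S(u))\theta(u,S(u))$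 for all $u\in[t,T]$ and $\int_t^T\|\theta(u,S(u))\|^2du<\infty$. Let $$\tilde Z^{\theta,t,s}(u)=\exp\Big(-\int_t^u\theta^{\mathsf T}(r,S(r))\,dW(r)-\frac12\int_t^u\|\theta(r,S(r))\|^2dr\Big),\qquad u\in[t,T],$$ be the stochastic discount factor, and for measurable $p:\mathbb R^d_+\to[0,\infty)$ put $h^p(t,s)=\mathbb E\big[\tilde Z^{\theta,t,s}(T)\,p(S^{t,s}(T))\big]$. Write $p^0\equiv1$ and $p^1(s)=s_1$. Then for every $L\in\mathbb R$ the four expectations below are finite and $$\mathbb E\big[\tilde Z^{\theta,t,s}(T)(L-S^{t,s}_1(T))^+\big]+h^{p^1}(t,s)=\mathbb E\big[\tilde Z^{\theta,t,s}(T)(S^{t,s}_1(T)-L)^+\big]+L\,h^{p^0}(t,s).$$ -/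

import Mathlib

open MeasureTheory ProbabilityTheory Filter Topology Set

/-- The open positive orthant of `ℝ^d`, the state space of the stock prices. -/
def positiveOrthant (d : ℕ) : Set (Fin d → ℝ) := {s | ∀ i, 0 < s i}

/-- `W` is a `K`-dimensional Brownian motion with independent components on the time interval
`[0, T]`, relative to the filtration `F`. -/
structure IsBrownianMotionOn {Ω : Type*} {mΩ : MeasurableSpace Ω} {K : ℕ}
    (P : Measure Ω) (F : Filtration ℝ mΩ) (T : ℝ) (W : ℝ → Ω → Fin K → ℝ) : Prop where
  adapted : ∀ u ∈ Icc 0 T, Measurable[F u] (W u)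
  start : ∀ᵐ ω ∂P, W 0 ω = 0
  continuous : ∀ᵐ ω ∂P, ContinuousOn (fun u => W u ω) (Icc 0 T)
  increment_law : ∀ r u, 0 ≤ r → r ≤ u → u ≤ T →
    P.map (fun ω => W u ω - W r ω) =
      Measure.pi (fun _ : Fin K => gaussianReal 0 (Real.toNNReal (u - r)))
  increment_indep : ∀ r u, 0 ≤ r → r ≤ u → u ≤ T →
    Indep (MeasurableSpace.comap (fun ω => W u ω - W r ω) inferInstance) (F r) P

/-- A bounded simple predictable `ℝ^K`-valued process on `[t, T]`:
`∑ i < n, value i · 1_{(time i, time (i+1)]}` with `value i` being `F (time i)`-measurable. -/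
structure SimpleProcess {Ω : Type*} {mΩ : MeasurableSpace Ω}
    (F : Filtration ℝ mΩ) (K : ℕ) (t T : ℝ) where
  n : ℕ
  time : ℕ → ℝ
  mono : Monotone time
  time_mem : ∀ i, time i ∈ Icc t T
  value : ℕ → Ω → Fin K → ℝ
  measurable_value : ∀ i, Measurable[F (time i)] (value i)
  bounded : ∃ C : ℝ, ∀ i ω k, |value i ω k| ≤ C

/-- The value at time `u` of a simple process. -/
noncomputable def SimpleProcess.eval {Ω : Type*} {mΩ : MeasurableSpace Ω}
    {F : Filtration ℝ mΩ} {K : ℕ} {t T : ℝ} (G : SimpleProcess F K t T)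
    (u : ℝ) (ω : Ω) (k : Fin K) : ℝ :=
  ∑ i ∈ Finset.range G.n, (Ioc (G.time i) (G.time (i + 1))).indicator (fun _ => G.value i ω k) u

/-- The elementary stochastic integral `∑ k ∫_t^u G_k dW_k` of a simple process. -/
noncomputable def SimpleProcess.integral {Ω : Type*} {mΩ : MeasurableSpace Ω}
    {F : Filtration ℝ mΩ} {K : ℕ} {t T : ℝ} (G : SimpleProcess F K t T)
    (W : ℝ → Ω → Fin K → ℝ) (u : ℝ) (ω : Ω) : ℝ :=
  ∑ i ∈ Finset.range G.n, ∑ k,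
    G.value i ω k * (W (min u (G.time (i + 1))) ω k - W (min u (G.time i)) ω k)

/-- `X` is (a version of) the Itô integral process `X u = ∑ k ∫_t^u H_k dW_k` for `u ∈ [t, T]`:
there are simple processes `G m` such that `∫_t^T ‖H - G m‖² du → 0` in probability and the
elementary integrals of `G m` converge to `X` in probability, uniformly on `[t, T]`. -/
def IsItoIntegral {Ω : Type*} {mΩ : MeasurableSpace Ω} {K : ℕ}
    (P : Measure Ω) (F : Filtration ℝ mΩ) (W : ℝ → Ω → Fin K → ℝ) (t T : ℝ)
    (H : ℝ → Ω → Fin K → ℝ) (X : ℝ → Ω → ℝ) : Prop :=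
  ∃ G : ℕ → SimpleProcess F K t T,
    (∀ ε : ℝ, 0 < ε → Tendsto (fun m => P {ω | ENNReal.ofReal ε ≤
      ∫⁻ u in Icc t T, ENNReal.ofReal (∑ k, (H u ω k - (G m).eval u ω k) ^ 2)}) atTop (𝓝 0)) ∧
    (∀ ε : ℝ, 0 < ε → Tendsto (fun m => P {ω | ∃ u ∈ Icc t T,
      ε ≤ |(G m).integral W u ω - X u ω|}) atTop (𝓝 0))

/-- `S = S^{t,s}` is a stock price process on `[t, T]`, started at time `t` in `s`, of the market
with mean rate of return `μ` and volatility `σ`: it is adapted, continuous, strictly positive,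
satisfies the integrability condition `∑ i ∫_t^T (|μ_i| + a_{i,i}) du < ∞` with `a = σ σᵀ`, and
`dS_i(u) = S_i(u) (μ_i(u, S(u)) du + ∑ k σ_{i,k}(u, S(u)) dW_k(u))`, `S(t) = s`. -/
structure IsStockPrice {Ω : Type*} {mΩ : MeasurableSpace Ω} {d K : ℕ}
    (P : Measure Ω) (F : Filtration ℝ mΩ) (T : ℝ) (W : ℝ → Ω → Fin K → ℝ)
    (μ : ℝ → (Fin d → ℝ) → Fin d → ℝ) (σ : ℝ → (Fin d → ℝ) → Matrix (Fin d) (Fin K) ℝ)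
    (t : ℝ) (s : Fin d → ℝ) (S : ℝ → Ω → Fin d → ℝ) : Prop where
  adapted : ∀ u ∈ Icc t T, Measurable[F u] (S u)
  continuous : ∀ᵐ ω ∂P, ContinuousOn (fun u => S u ω) (Icc t T)
  positive : ∀ᵐ ω ∂P, ∀ u ∈ Icc t T, S u ω ∈ positiveOrthant d
  integrable : ∀ i, ∀ᵐ ω ∂P, IntegrableOn
    (fun u => |μ u (S u ω) i| + (σ u (S u ω) * (σ u (S u ω)).transpose) i i) (Icc t T)
  dynamics : ∀ i, ∃ I : ℝ → Ω → ℝ,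
    IsItoIntegral P F W t T (fun u ω k => S u ω i * σ u (S u ω) i k) I ∧
    ∀ᵐ ω ∂P, ∀ u ∈ Icc t T,
      S u ω i = s i + (∫ r in t..u, S r ω i * μ r (S r ω) i) + I u ω

/-- The function `θ` is a Markovian square-integrable market price of risk along the stock price
process `S` on `[t, T]`. -/
structure IsMarkovianMPR {Ω : Type*} {mΩ : MeasurableSpace Ω} {d K : ℕ}
    (P : Measure Ω) (T : ℝ)
    (μ : ℝ → (Fin d → ℝ) → Fin d → ℝ) (σ : ℝ → (Fin d → ℝ) → Matrix (Fin d) (Fin K) ℝ)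
    (t : ℝ) (S : ℝ → Ω → Fin d → ℝ) (θ : ℝ → (Fin d → ℝ) → Fin K → ℝ) : Prop where
  measurable : Measurable (fun x : ℝ × (Fin d → ℝ) => θ x.1 x.2)
  eq : ∀ᵐ ω ∂P, ∀ u ∈ Icc t T, μ u (S u ω) = (σ u (S u ω)).mulVec (θ u (S u ω))
  sq_integrable : ∀ᵐ ω ∂P, IntegrableOn (fun u => ∑ k, θ u (S u ω) k ^ 2) (Icc t T)

/-- `Z` is the stochastic discount factor on `[t, T]`, normalised to `1` at time `t`:
`Z(u) = exp (- ∫_t^u θᵀ(r, S(r)) dW(r) - 1/2 ∫_t^u ‖θ(r, S(r))‖² dr)`. -/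
def IsStochasticDiscountFactor {Ω : Type*} {mΩ : MeasurableSpace Ω} {d K : ℕ}
    (P : Measure Ω) (F : Filtration ℝ mΩ) (T : ℝ) (W : ℝ → Ω → Fin K → ℝ)
    (t : ℝ) (S : ℝ → Ω → Fin d → ℝ) (θ : ℝ → (Fin d → ℝ) → Fin K → ℝ)
    (Z : ℝ → Ω → ℝ) : Prop :=
  ∃ I : ℝ → Ω → ℝ, IsItoIntegral P F W t T (fun u ω => θ u (S u ω)) I ∧
    ∀ᵐ ω ∂P, ∀ u ∈ Icc t T,
      Z u ω = Real.exp (- I u ω - (1 / 2) * ∫ r in t..u, ∑ k, θ r (S r ω) k ^ 2)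

/-- The discounted payoff `Z(T) p(S(T))` of the European claim `p`. -/
def discountedPayoff {Ω : Type*} {d : ℕ} (T : ℝ) (S : ℝ → Ω → Fin d → ℝ) (Z : ℝ → Ω → ℝ)
    (p : (Fin d → ℝ) → ℝ) (ω : Ω) : ℝ :=
  Z T ω * p (S T ω)

/-- The hedging price `h^p(t, s) = E^{t,s}[Z(T) p(S(T))]`, where `S = S^{t,s}` is the stock price
process started at time `t` in `s` and `Z` its stochastic discount factor from time `t` on. -/
noncomputable def hedgingPrice {Ω : Type*} {mΩ : MeasurableSpace Ω} {d : ℕ} (P : Measure Ω)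
    (T : ℝ) (S : ℝ → Ω → Fin d → ℝ) (Z : ℝ → Ω → ℝ) (p : (Fin d → ℝ) → ℝ) : ℝ :=
  ∫ ω, discountedPayoff T S Z p ω ∂P

/-- The payoff `p^0 ≡ 1` of one monetary unit. -/
def moneyPayoff (d : ℕ) : (Fin d → ℝ) → ℝ := fun _ => 1

/-- The payoff `p^1(s) = s_1` of the first stock. -/
def stockPayoff (d : ℕ) [NeZero d] : (Fin d → ℝ) → ℝ := fun s => s 0

/-- The payoff `(s_1 - L)^+` of the call with strike `L` on the first stock. -/
def callPayoff (d : ℕ) [NeZero d] (L : ℝ) : (Fin d → ℝ) → ℝ := fun s => max (s 0 - L) 0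

/-- The payoff `(L - s_1)^+` of the put with strike `L` on the first stock. -/
def putPayoff (d : ℕ) [NeZero d] (L : ℝ) : (Fin d → ℝ) → ℝ := fun s => max (L - s 0) 0

/-!
# Modified put-call parity

Pointwise, `(L - x)⁺ + x = (x - L)⁺ + L`, so the identity follows by linearity of the expectation
as soon as `Z(T)` and `Z(T) S₁(T)` are integrable, all payoffs involved being dominated by a
multiple of `x + 2`. This integrability is the substance. Itô's formula makes `Z` and `Z S₁`
nonnegative local martingales, hence supermartingales; the proof below reaches the bound
`E[Z(T) (S₁(T) + 2)] < ∞` without Itô's formula, from the approximations by simple processes that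
define the stochastic integrals.

Let simple processes `G` and `H` approximate `θ` and `S₁ σ₁`. Because `μ = σ θ`, the price `S₁` is
approximated, uniformly in time, by `X = s₁ + ∫ H·G dr + ∫ H dW` (`SimpleProcess.price`), and `Z`
by `exp (- ∫ G dW - 1/2 ∫ |G|² dr)` (`SimpleProcess.discount`). The product of these two processes
is an exact martingale, by the Gaussian exponential moments of a single increment, but `X` may
become negative. The product of the discount with `X + 2` is therefore killed as soon as `X` falls
below `-1` at a time of a partition. Killing raises the expectation only through the event that a
single step leads from above `-1` to below `-2`, where a negative value is discarded; for a Gaussian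
step of variance at most `κ` this costs at most a factor `1 + 9 κ²` (`lintegral_tilted_le`,
`SimpleProcess.lintegral_killed_le`). Since the number of steps is of order `1 / κ`, a fine
partition leaves a bound independent of the simple processes
(`SimpleProcess.exists_lintegral_discount_mul_price_le`). Almost surely along a subsequence, the
approximations converge and no killing occurs eventually, the true price being positive, so that
Fatou's lemma gives the bound (`aemeasurable_and_lintegral_discount_mul_stock_lt_top`).
-/

/-! ### Gaussian increments -/

/-- The moment generating function of a centred Gaussian vector with independent components of
variance `δ`. -/
lemma integrable_and_integral_exp_sum_pi_gaussianReal {K : ℕ} (δ : ℝ) (hδ : 0 ≤ δ)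
    (c : Fin K → ℝ) :
    Integrable (fun w : Fin K → ℝ => Real.exp (∑ k, c k * w k))
      (Measure.pi (fun _ : Fin K => gaussianReal 0 (Real.toNNReal δ))) ∧
    ∫ w, Real.exp (∑ k, c k * w k)
      ∂(Measure.pi (fun _ : Fin K => gaussianReal 0 (Real.toNNReal δ))) =
      Real.exp (δ / 2 * ∑ k, c k ^ 2) := by
  simp_rw [Real.exp_sum]
  constructor
  · exact Integrable.fintype_prod (f := fun k x => Real.exp (c k * x))
      fun k => integrable_exp_mul_gaussianReal _
  · rw [integral_fintype_prod_eq_prod (fun k x => Real.exp (c k * x)), Finset.mul_sum,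
      Real.exp_sum]
    refine Finset.prod_congr rfl fun k _ => ?_
    have h := congrFun (mgf_id_gaussianReal (μ := 0) (v := Real.toNNReal δ)) (c k)
    simp only [mgf, id] at h
    rw [h, Real.coe_toNNReal _ hδ]
    ring_nf

/-- Under the exponential change of measure with drift `-g`, the variable
`δ h·g + h·w` is centred Gaussian with variance `δ |h|²`. -/
lemma integrable_and_integral_tilted {K : ℕ} (δ : ℝ) (hδ : 0 ≤ δ) (g h : Fin K → ℝ) (b : ℝ) :
    Integrable (fun w : Fin K → ℝ => Real.exp (-(∑ k, g k * w k) - 1 / 2 * (δ * ∑ k, g k ^ 2)) *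
        Real.exp (b * (δ * (∑ k, h k * g k) + ∑ k, h k * w k)))
      (Measure.pi (fun _ : Fin K => gaussianReal 0 (Real.toNNReal δ))) ∧
    ∫ w, Real.exp (-(∑ k, g k * w k) - 1 / 2 * (δ * ∑ k, g k ^ 2)) *
        Real.exp (b * (δ * (∑ k, h k * g k) + ∑ k, h k * w k))
      ∂(Measure.pi (fun _ : Fin K => gaussianReal 0 (Real.toNNReal δ))) =
      Real.exp (b ^ 2 * (δ * ∑ k, h k ^ 2) / 2) := by
  obtain ⟨h1, h2⟩ := integrable_and_integral_exp_sum_pi_gaussianReal δ hδ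
    (fun k => b * h k - g k)
  have e : ∀ w : Fin K → ℝ, Real.exp (-(∑ k, g k * w k) - 1 / 2 * (δ * ∑ k, g k ^ 2)) *
      Real.exp (b * (δ * (∑ k, h k * g k) + ∑ k, h k * w k)) =
      Real.exp (∑ k, (b * h k - g k) * w k) *
        Real.exp (b * (δ * (∑ k, h k * g k)) - 1 / 2 * (δ * ∑ k, g k ^ 2)) := by
    intro w
    rw [← Real.exp_add, ← Real.exp_add]
    congr 1
    simp only [sub_mul, Finset.sum_sub_distrib, mul_assoc, ← Finset.mul_sum]
    ring
  simp_rw [e]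
  refine ⟨h1.mul_const _, ?_⟩
  rw [integral_mul_const, h2, ← Real.exp_add]
  congr 1
  have : ∑ k, (b * h k - g k) ^ 2 =
      b ^ 2 * ∑ k, h k ^ 2 - 2 * b * ∑ k, h k * g k + ∑ k, g k ^ 2 := by
    simp only [Finset.mul_sum, ← Finset.sum_sub_distrib, ← Finset.sum_add_distrib]
    exact Finset.sum_congr rfl fun k _ => by ring
  rw [this]
  ring

/-- The positive part of `y + x` is dominated by `y + x` up to exponentials whose Gaussian
expectations are explicit. -/
lemma max_add_le_exp {y x a l : ℝ} (hy : 1 ≤ y) (ha : 0 < a) (hl : 1 ≤ l) :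
    max (y + x) 0 ≤ (y - 1 / a) + 1 / a * Real.exp (a * x) +
      Real.exp (-l) * Real.exp (-l * x) := by
  have h1 : x + 1 / a ≤ 1 / a * Real.exp (a * x) := by
    have := Real.add_one_le_exp (a * x)
    calc x + 1 / a = 1 / a * (a * x + 1) := by field_simp
      _ ≤ _ := by gcongr
  have h2 : 0 < Real.exp (-l) * Real.exp (-l * x) := by positivity
  refine max_le (by linarith) ?_
  by_cases hx : 0 ≤ y + x
  · linarith
  · push Not at hx
    have h3 : -(y + x) ≤ Real.exp (-l) * Real.exp (-l * x) := by
      rw [← Real.exp_add]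
      have := Real.add_one_le_exp (-l + -l * x)
      nlinarith
    linarith

/-- One Gaussian step of the killed martingale `Z (X + 2)`: taking positive parts costs only a
factor `1 + O(κ²)`, where `κ` bounds the variance of the step. -/
lemma lintegral_tilted_le {K : ℕ} (δ : ℝ) (hδ : 0 ≤ δ) (g h : Fin K → ℝ) {κ y : ℝ}
    (hκ : 0 < κ) (hκ1 : κ ≤ 1) (hv : δ * ∑ k, h k ^ 2 ≤ κ) (hy : 1 ≤ y) :
    ∫⁻ w, ENNReal.ofReal (Real.exp (-(∑ k, g k * w k) - 1 / 2 * (δ * ∑ k, g k ^ 2)) *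
        (y + (δ * (∑ k, h k * g k) + ∑ k, h k * w k)))
      ∂(Measure.pi (fun _ : Fin K => gaussianReal 0 (Real.toNNReal δ))) ≤
      ENNReal.ofReal (1 + 9 * κ ^ 2) * ENNReal.ofReal y := by
  set ν := Measure.pi (fun _ : Fin K => gaussianReal 0 (Real.toNNReal δ))
  set v := δ * ∑ k, h k ^ 2 with hvdef
  have hv0 : 0 ≤ v := mul_nonneg hδ (Finset.sum_nonneg fun k _ => sq_nonneg _)
  set E : (Fin K → ℝ) → ℝ :=
    fun w => Real.exp (-(∑ k, g k * w k) - 1 / 2 * (δ * ∑ k, g k ^ 2))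
  set ξ : (Fin K → ℝ) → ℝ := fun w => δ * (∑ k, h k * g k) + ∑ k, h k * w k
  -- the domination by exponentials is used with `a = κ` and `l = 1 / κ`, which makes both errors
  -- quadratic in `κ`
  obtain ⟨i0, e0⟩ := integrable_and_integral_tilted δ hδ g h 0
  obtain ⟨i1, e1⟩ := integrable_and_integral_tilted δ hδ g h κ
  obtain ⟨i2, e2⟩ := integrable_and_integral_tilted δ hδ g h (-(1 / κ))
  change Integrable (fun w => E w * Real.exp (0 * ξ w)) ν at i0
  change Integrable (fun w => E w * Real.exp (κ * ξ w)) ν at i1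
  change Integrable (fun w => E w * Real.exp (-(1 / κ) * ξ w)) ν at i2
  change ∫ w, E w * Real.exp (0 * ξ w) ∂ν = Real.exp (0 ^ 2 * v / 2) at e0
  change ∫ w, E w * Real.exp (κ * ξ w) ∂ν = Real.exp (κ ^ 2 * v / 2) at e1
  change ∫ w, E w * Real.exp (-(1 / κ) * ξ w) ∂ν = Real.exp ((-(1 / κ)) ^ 2 * v / 2) at e2
  simp only [zero_mul, Real.exp_zero, mul_one, ne_eq, OfNat.ofNat_ne_zero, not_false_eq_true,
    zero_pow, zero_div] at i0 e0
  set R : (Fin K → ℝ) → ℝ := fun w => (y - 1 / κ) * E w + 1 / κ * (E w * Real.exp (κ * ξ w)) +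
    Real.exp (-(1 / κ)) * (E w * Real.exp (-(1 / κ) * ξ w)) with hR
  have hl : 1 ≤ 1 / κ := by rw [le_div_iff₀ hκ]; linarith
  have hle : ∀ w, max (E w * (y + ξ w)) 0 ≤ R w := by
    intro w
    have hEw : 0 < E w := Real.exp_pos _
    have h1 := mul_le_mul_of_nonneg_left (max_add_le_exp (x := ξ w) hy hκ hl) hEw.le
    rw [mul_max_of_nonneg _ _ hEw.le, mul_zero] at h1
    refine h1.trans_eq ?_
    simp only [hR]
    ring
  have hRi : Integrable R ν := ((i0.const_mul _).add (i1.const_mul _)).add (i2.const_mul _)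
  have hRe : ∫ w, R w ∂ν = (y - 1 / κ) + 1 / κ * Real.exp (κ ^ 2 * v / 2) +
      Real.exp (-(1 / κ)) * Real.exp ((-(1 / κ)) ^ 2 * v / 2) := by
    rw [show R = fun w => _ from hR, integral_add (f := fun w => (y - 1 / κ) * E w +
        1 / κ * (E w * Real.exp (κ * ξ w))) ((i0.const_mul _).add (i1.const_mul _))
        (i2.const_mul _),
      integral_add (i0.const_mul _) (i1.const_mul _)]
    simp only [integral_const_mul, e0, e1, e2, mul_one]
  have b1 : 1 / κ * Real.exp (κ ^ 2 * v / 2) ≤ 1 / κ + κ ^ 2 := by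
    have h0 : 0 ≤ κ ^ 2 * v / 2 := by positivity
    have h1 : κ ^ 2 * v / 2 ≤ κ ^ 3 / 2 := by
      have := mul_le_mul_of_nonneg_left hv (sq_nonneg κ)
      nlinarith
    have h3 : κ ^ 3 ≤ 1 := pow_le_one₀ hκ.le hκ1
    have h2 := Real.abs_exp_sub_one_le (x := κ ^ 2 * v / 2) (by rw [abs_of_nonneg h0]; linarith)
    rw [abs_of_nonneg h0] at h2
    have h4 : Real.exp (κ ^ 2 * v / 2) ≤ 1 + κ ^ 3 := by linarith [(le_abs_self _).trans h2]
    calc 1 / κ * Real.exp (κ ^ 2 * v / 2) ≤ 1 / κ * (1 + κ ^ 3) := by gcongr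
      _ = _ := by field_simp
  have b2 : Real.exp (-(1 / κ)) * Real.exp ((-(1 / κ)) ^ 2 * v / 2) ≤ 8 * κ ^ 2 := by
    rw [← Real.exp_add]
    have h1 : -(1 / κ) + (-(1 / κ)) ^ 2 * v / 2 ≤ -(1 / (2 * κ)) := by
      have : (-(1 / κ)) ^ 2 * v / 2 ≤ (-(1 / κ)) ^ 2 * κ / 2 := by gcongr
      have e : (-(1 / κ)) ^ 2 * κ / 2 = 1 / (2 * κ) := by field_simp
      have e' : 1 / κ = 1 / (2 * κ) + 1 / (2 * κ) := by field_simp; norm_num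
      linarith
    refine (Real.exp_le_exp.2 h1).trans ?_
    rw [Real.exp_neg, inv_le_comm₀ (Real.exp_pos _) (by positivity)]
    have h2 := Real.quadratic_le_exp_of_nonneg (x := 1 / (2 * κ)) (by positivity)
    have h3 : (8 * κ ^ 2)⁻¹ = (1 / (2 * κ)) ^ 2 / 2 := by field_simp; norm_num
    have : 0 < 1 / (2 * κ) := by positivity
    rw [h3]; linarith
  calc _ ≤ ∫⁻ w, ENNReal.ofReal (R w) ∂ν :=
        lintegral_mono fun w => ENNReal.ofReal_le_ofReal ((le_max_left _ _).trans (hle w))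
    _ = ENNReal.ofReal (∫ w, R w ∂ν) :=
        (ofReal_integral_eq_lintegral_ofReal hRi
          (ae_of_all _ fun w => (le_max_right _ _).trans (hle w))).symm
    _ ≤ ENNReal.ofReal ((1 + 9 * κ ^ 2) * y) := by
        refine ENNReal.ofReal_le_ofReal ?_
        rw [hRe]
        nlinarith [sq_nonneg κ]
    _ = _ := ENNReal.ofReal_mul (by positivity)

/-- The Gaussian step for coefficients known at the beginning of the step, obtained by freezing
them through the independence of the increment from the past. -/
lemma lintegral_step_le {Ω : Type*} {m mΩ : MeasurableSpace Ω} {K : ℕ} (P : Measure Ω)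
    [IsProbabilityMeasure P] (hm : m ≤ mΩ) (D : Ω → Fin K → ℝ)
    (hD : Measurable D) {δ : ℝ} (hδ : 0 ≤ δ)
    (hlaw : P.map D = Measure.pi (fun _ : Fin K => gaussianReal 0 (Real.toNNReal δ)))
    (hind : Indep (MeasurableSpace.comap D inferInstance) m P)
    {z y : Ω → ℝ} {g h : Ω → Fin K → ℝ} (hz : Measurable[m] z) (hy : Measurable[m] y)
    (hg : Measurable[m] g) (hh : Measurable[m] h) (hz0 : ∀ ω, 0 ≤ z ω)
    (hzy : ∀ ω, z ω = 0 ∨ 1 ≤ y ω) {κ : ℝ} (hκ : 0 < κ) (hκ1 : κ ≤ 1)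
    (hv : ∀ ω, δ * ∑ k, h ω k ^ 2 ≤ κ) :
    ∫⁻ ω, ENNReal.ofReal (z ω *
        (Real.exp (-(∑ k, g ω k * D ω k) - 1 / 2 * (δ * ∑ k, g ω k ^ 2)) *
          (y ω + (δ * (∑ k, h ω k * g ω k) + ∑ k, h ω k * D ω k)))) ∂P ≤
      ENNReal.ofReal (1 + 9 * κ ^ 2) * ∫⁻ ω, ENNReal.ofReal (z ω * y ω) ∂P := by
  set V : Ω → (ℝ × ℝ) × (Fin K → ℝ) × (Fin K → ℝ) := fun ω => ((z ω, y ω), (g ω, h ω)) with hV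
  have hVm : Measurable[m] V := (hz.prodMk hy).prodMk (hg.prodMk hh)
  have hVm' : Measurable V := hVm.mono hm le_rfl
  have hVD : IndepFun V D P := by
    refine (indep_of_indep_of_le_right hind ?_).symm
    exact hVm.comap_le
  let f : ((ℝ × ℝ) × (Fin K → ℝ) × (Fin K → ℝ)) × (Fin K → ℝ) → ENNReal := fun p =>
    ENNReal.ofReal (p.1.1.1 *
        (Real.exp (-(∑ k, p.1.2.1 k * p.2 k) - 1 / 2 * (δ * ∑ k, p.1.2.1 k ^ 2)) *
          (p.1.1.2 + (δ * (∑ k, p.1.2.2 k * p.1.2.1 k) + ∑ k, p.1.2.2 k * p.2 k))))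
  have hf : Measurable f := by
    refine ENNReal.measurable_ofReal.comp (Continuous.measurable ?_)
    fun_prop
  have e1 : ∫⁻ ω, f (V ω, D ω) ∂P = ∫⁻ ω, ∫⁻ w, f (V ω, w) ∂(P.map D) ∂P := by
    rw [← lintegral_map hf (hVm'.prodMk hD),
      (indepFun_iff_map_prod_eq_prod_map_map hVm'.aemeasurable hD.aemeasurable).1 hVD,
      lintegral_prod _ hf.aemeasurable, lintegral_map hf.lintegral_prod_right' hVm']
  refine (show _ = ∫⁻ ω, f (V ω, D ω) ∂P from rfl).trans_le ?_
  rw [e1, hlaw, ← lintegral_const_mul' _ _ ENNReal.ofReal_ne_top]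
  refine lintegral_mono fun ω => ?_
  simp only [f, hV]
  simp_rw [ENNReal.ofReal_mul (hz0 ω)]
  rw [lintegral_const_mul' _ _ ENNReal.ofReal_ne_top]
  rcases hzy ω with h0 | h1
  · simp [h0]
  · refine (mul_le_mul_right (lintegral_tilted_le δ hδ (g ω) (h ω) hκ hκ1 (hv ω) h1) _).trans_eq ?_
    ring

/-! ### Simple processes along a partition -/

namespace SimpleProcess

variable {Ω : Type*} {mΩ : MeasurableSpace Ω} {F : Filtration ℝ mΩ} {K : ℕ} {t T : ℝ}

/-- No jump time of `G` lies strictly between `r` and `u`. Only the times with index at most `G.n`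
matter, the later ones being unused by `G.eval`. -/
def NoJump (G : SimpleProcess F K t T) (r u : ℝ) : Prop :=
  ∀ i, i ≤ G.n → G.time i ≤ r ∨ u ≤ G.time i

lemma eval_eq_of_noJump (G : SimpleProcess F K t T) {r u x : ℝ} (h : G.NoJump r u)
    (hx : x ∈ Ioc r u) (ω : Ω) (k : Fin K) : G.eval x ω k = G.eval u ω k := by
  refine Finset.sum_congr rfl fun i hi => ?_
  have hi' := Finset.mem_range.1 hi
  have : x ∈ Ioc (G.time i) (G.time (i + 1)) ↔ u ∈ Ioc (G.time i) (G.time (i + 1)) := by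
    have h1 := h i hi'.le
    have h2 := h (i + 1) hi'
    simp only [mem_Ioc] at hx ⊢
    constructor
    · rintro ⟨a, b⟩
      refine ⟨by linarith, ?_⟩
      rcases h2 with h2 | h2 <;> linarith
    · rintro ⟨a, b⟩
      refine ⟨?_, by linarith⟩
      rcases h1 with h1 | h1 <;> linarith
  by_cases hu : u ∈ Ioc (G.time i) (G.time (i + 1))
  · rw [indicator_of_mem hu, indicator_of_mem (this.2 hu)]
  · rw [indicator_of_notMem hu, indicator_of_notMem (fun h => hu (this.1 h))]

/-- Predictability: on an interval without jump times the value is known at its left end. -/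
lemma measurable_eval_of_noJump (G : SimpleProcess F K t T) {r u : ℝ} (h : G.NoJump r u) :
    Measurable[F r] (G.eval u) := by
  refine @measurable_pi_lambda _ _ _ (F r) _ _ fun k => ?_
  refine Finset.measurable_fun_sum _ fun i hi => ?_
  have hi' := Finset.mem_range.1 hi
  by_cases hu : u ∈ Ioc (G.time i) (G.time (i + 1))
  · simp only [indicator_of_mem hu]
    have h1 : G.time i ≤ r := by
      rcases h i hi'.le with h1 | h1
      · exact h1
      · exact absurd hu.1 (not_lt.2 h1)
    exact (measurable_pi_apply k).comp ((G.measurable_value i).mono (F.mono h1) le_rfl)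
  · simp only [indicator_of_notMem hu]
    exact measurable_const

lemma exists_abs_eval_le (G : SimpleProcess F K t T) :
    ∃ C : ℝ, 0 ≤ C ∧ ∀ u ω k, |G.eval u ω k| ≤ C := by
  obtain ⟨C, hC⟩ := G.bounded
  refine ⟨G.n * |C|, by positivity, fun u ω k => ?_⟩
  refine (Finset.abs_sum_le_sum_abs _ _).trans ?_
  refine (Finset.sum_le_card_nsmul _ _ |C| fun i _ => ?_).trans (by simp)
  by_cases hu : u ∈ Ioc (G.time i) (G.time (i + 1))
  · rw [indicator_of_mem hu]
    exact (hC i ω k).trans (le_abs_self C)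
  · rw [indicator_of_notMem hu]
    simp

lemma measurable_eval_time (G : SimpleProcess F K t T) (ω : Ω) (k : Fin K) :
    Measurable fun u => G.eval u ω k :=
  Finset.measurable_fun_sum _ fun _ _ => measurable_const.indicator measurableSet_Ioc

lemma intervalIntegrable_eval_mul_eval (G H : SimpleProcess F K t T) (ω : Ω) (r u : ℝ) :
    IntervalIntegrable (fun x => ∑ k, H.eval x ω k * G.eval x ω k) volume r u := by
  obtain ⟨C, hC0, hC⟩ := G.exists_abs_eval_le
  obtain ⟨C', hC0', hC'⟩ := H.exists_abs_eval_le
  refine IntervalIntegrable.mono_fun (intervalIntegrable_const (c := ∑ _k : Fin K, C' * C)) ?_ ?_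
  · exact (Finset.measurable_fun_sum _ fun k _ =>
      (H.measurable_eval_time ω k).mul (G.measurable_eval_time ω k)).aestronglyMeasurable
  · refine ae_of_all _ fun x => ?_
    simp only [Real.norm_eq_abs]
    refine (Finset.abs_sum_le_sum_abs _ _).trans (le_trans ?_ (le_abs_self _))
    refine Finset.sum_le_sum fun k _ => ?_
    rw [abs_mul]
    exact mul_le_mul (hC' _ _ _) (hC _ _ _) (abs_nonneg _) hC0'

lemma integral_eval_mul_eval_of_noJump (G H : SimpleProcess F K t T) {r u : ℝ} (hru : r ≤ u)
    (hG : G.NoJump r u) (hH : H.NoJump r u) (ω : Ω) :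
    ∫ x in t..u, ∑ k, H.eval x ω k * G.eval x ω k =
      (∫ x in t..r, ∑ k, H.eval x ω k * G.eval x ω k) +
        (u - r) * ∑ k, H.eval u ω k * G.eval u ω k := by
  rw [← intervalIntegral.integral_add_adjacent_intervals
    (intervalIntegrable_eval_mul_eval G H ω t r) (intervalIntegrable_eval_mul_eval G H ω r u)]
  congr 1
  rw [intervalIntegral.integral_of_le hru, setIntegral_congr_fun measurableSet_Ioc
    (g := fun _ => ∑ k, H.eval u ω k * G.eval u ω k)]
  · rw [← intervalIntegral.integral_of_le hru, intervalIntegral.integral_const, smul_eq_mul]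
  · intro x hx
    refine Finset.sum_congr rfl fun k _ => ?_
    rw [G.eval_eq_of_noJump hG hx, H.eval_eq_of_noJump hH hx]

lemma integral_start (G : SimpleProcess F K t T) (W : ℝ → Ω → Fin K → ℝ) (ω : Ω) :
    G.integral W t ω = 0 := by
  refine Finset.sum_eq_zero fun i _ => Finset.sum_eq_zero fun k _ => ?_
  rw [min_eq_left (G.time_mem i).1, min_eq_left (G.time_mem (i + 1)).1, sub_self, mul_zero]

lemma integral_of_noJump (G : SimpleProcess F K t T) (W : ℝ → Ω → Fin K → ℝ) {r u : ℝ}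
    (hru : r < u) (h : G.NoJump r u) (ω : Ω) :
    G.integral W u ω = G.integral W r ω + ∑ k, G.eval u ω k * (W u ω k - W r ω k) := by
  simp only [integral, eval, Finset.sum_mul]
  rw [Finset.sum_comm (s := Finset.univ), ← Finset.sum_add_distrib]
  refine Finset.sum_congr rfl fun i hi => ?_
  rw [← Finset.sum_add_distrib]
  refine Finset.sum_congr rfl fun k _ => ?_
  have hi' := Finset.mem_range.1 hi
  have hm := G.mono (Nat.le_succ i)
  simp only [Nat.succ_eq_add_one] at hm
  rcases h (i + 1) hi' with h2 | h2
  · rw [indicator_of_notMem (fun hu => by linarith [hu.2]), min_eq_right (h2.trans hru.le),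
      min_eq_right (hm.trans (h2.trans hru.le)), min_eq_right h2, min_eq_right (hm.trans h2)]
    ring
  · rw [min_eq_left h2, min_eq_left (hru.le.trans h2)]
    rcases h i hi'.le with h1 | h1
    · rw [indicator_of_mem (mem_Ioc.2 ⟨h1.trans_lt hru, h2⟩), min_eq_right (h1.trans hru.le),
        min_eq_right h1]
      ring
    · rw [indicator_of_notMem (fun hu => by linarith [hu.1]), min_eq_left h1,
        min_eq_left (hru.le.trans h1)]
      ring

/-- The exponential martingale `exp (- ∫ G dW - 1/2 ∫ |G|² dr)` started at time `t`. -/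
noncomputable def discount (G : SimpleProcess F K t T) (W : ℝ → Ω → Fin K → ℝ) (u : ℝ) (ω : Ω) :
    ℝ :=
  Real.exp (-G.integral W u ω - 1 / 2 * ∫ r in t..u, ∑ k, G.eval r ω k * G.eval r ω k)

/-- The process `x + ∫ H·G dr + ∫ H dW`, whose drift is exactly the one that makes its product
with `G.discount` driftless. -/
noncomputable def price (H G : SimpleProcess F K t T) (x : ℝ) (W : ℝ → Ω → Fin K → ℝ) (u : ℝ)
    (ω : Ω) : ℝ :=
  x + (∫ r in t..u, ∑ k, H.eval r ω k * G.eval r ω k) + H.integral W u ω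

/-- Along a partition refining the jump times, the product of the discount and of the price
shifted by `2`, killed when the price falls below `-1` at a partition time, is nearly a
supermartingale. -/
lemma lintegral_killed_le {P : Measure Ω} [IsProbabilityMeasure P] {W : ℝ → Ω → Fin K → ℝ}
    (hW : IsBrownianMotionOn P F T W) (ht : 0 ≤ t) (H G : SimpleProcess F K t T) {x κ : ℝ}
    (hκ : 0 < κ) (hκ1 : κ ≤ 1) {n : ℕ} {π : ℕ → ℝ} (h0 : π 0 = t)
    (hπ : ∀ j ≤ n, π j ∈ Icc t T)
    (hlt : ∀ j < n, π j < π (j + 1)) (hG : ∀ j < n, G.NoJump (π j) (π (j + 1)))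
    (hH : ∀ j < n, H.NoJump (π j) (π (j + 1)))
    (hv : ∀ j < n, ∀ ω, (π (j + 1) - π j) * ∑ k, H.eval (π (j + 1)) ω k ^ 2 ≤ κ) :
    ∀ j ≤ n, Measurable[F (π j)] (H.price G x W (π j)) ∧
      Measurable[F (π j)] (G.discount W (π j)) ∧
      MeasurableSet[F (π j)] {ω | ∀ i ≤ j, -1 ≤ H.price G x W (π i) ω} ∧
      ∫⁻ ω, ENNReal.ofReal ({ω | ∀ i ≤ j, -1 ≤ H.price G x W (π i) ω}.indicator
        (G.discount W (π j)) ω * (H.price G x W (π j) ω + 2)) ∂P ≤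
        ENNReal.ofReal (1 + 9 * κ ^ 2) ^ j * ENNReal.ofReal (x + 2) := by
  intro j
  induction j with
  | zero =>
    intro _
    have e1 : ∀ ω, H.price G x W (π 0) ω = x := fun ω => by
      simp [price, h0, integral_start]
    have e2 : ∀ ω, G.discount W (π 0) ω = 1 := fun ω => by
      simp [discount, h0, integral_start]
    have e1' : H.price G x W (π 0) = fun _ => x := funext e1
    have e2' : G.discount W (π 0) = fun _ => 1 := funext e2
    refine ⟨by rw [e1']; exact measurable_const, by rw [e2']; exact measurable_const, ?_, ?_⟩
    · simp only [Nat.le_zero, forall_eq, e1]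
      exact MeasurableSet.const _
    · rw [pow_zero, one_mul, e1', e2']
      by_cases hx : -1 ≤ x
      · simp [e1, hx]
      · simp [e1, hx]
  | succ j ih =>
    intro hj
    obtain ⟨mX, mZ, mB, hI⟩ := ih (by omega)
    have hjn : j < n := hj
    have hl := hlt j hjn
    have hr := hπ j hjn.le
    have hu := hπ (j + 1) hj
    set r := π j with hrdef
    set u := π (j + 1) with hudef
    set B := {ω | ∀ i ≤ j, -1 ≤ H.price G x W (π i) ω} with hB
    set D : Ω → Fin K → ℝ := fun ω => W u ω - W r ω with hD
    have hFru : F r ≤ F u := F.mono hl.le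
    have mWu := hW.adapted u ⟨ht.trans hu.1, hu.2⟩
    have mWr := hW.adapted r ⟨ht.trans hr.1, hr.2⟩
    have mD : Measurable[F u] D := by
      exact mWu.sub (mWr.mono hFru le_rfl)
    have mg := G.measurable_eval_of_noJump (hG j hjn)
    have mh := H.measurable_eval_of_noJump (hH j hjn)
    have eX : ∀ ω, H.price G x W u ω = H.price G x W r ω +
        ((u - r) * (∑ k, H.eval u ω k * G.eval u ω k) + ∑ k, H.eval u ω k * D ω k) := by
      intro ω
      simp only [price]
      rw [integral_eval_mul_eval_of_noJump G H hl.le (hG j hjn) (hH j hjn),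
        H.integral_of_noJump W hl (hH j hjn)]
      simp only [hD, Pi.sub_apply]
      ring
    have eZ : ∀ ω, G.discount W u ω = G.discount W r ω * Real.exp (-(∑ k, G.eval u ω k * D ω k) -
        1 / 2 * ((u - r) * ∑ k, G.eval u ω k ^ 2)) := by
      intro ω
      simp only [discount]
      rw [← Real.exp_add, integral_eval_mul_eval_of_noJump G G hl.le (hG j hjn) (hG j hjn),
        G.integral_of_noJump W hl (hG j hjn)]
      congr 1
      simp only [hD, Pi.sub_apply, pow_two]
      ring
    have mg' : ∀ k, Measurable[F u] fun ω => G.eval u ω k := fun k =>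
      (measurable_pi_apply k).comp (mg.mono hFru le_rfl)
    have mh' : ∀ k, Measurable[F u] fun ω => H.eval u ω k := fun k =>
      (measurable_pi_apply k).comp (mh.mono hFru le_rfl)
    have mD' : ∀ k, Measurable[F u] fun ω => D ω k := fun k => (measurable_pi_apply k).comp mD
    have mXu : Measurable[F u] (H.price G x W u) := by
      rw [funext eX]
      refine (mX.mono hFru le_rfl).add (Measurable.add ?_ ?_)
      · exact (Finset.measurable_fun_sum _ fun k _ => (mh' k).mul (mg' k)).const_mul _
      · exact Finset.measurable_fun_sum _ fun k _ => (mh' k).mul (mD' k)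
    have mZu : Measurable[F u] (G.discount W u) := by
      rw [funext eZ]
      refine (mZ.mono hFru le_rfl).mul (Real.measurable_exp.comp (Measurable.sub ?_ ?_))
      · exact (Finset.measurable_fun_sum _ fun k _ => (mg' k).mul (mD' k)).neg
      · exact ((Finset.measurable_fun_sum _ fun k _ => (mg' k).pow_const 2).const_mul _).const_mul _
    have eB : {ω | ∀ i ≤ j + 1, -1 ≤ H.price G x W (π i) ω} =
        B ∩ {ω | -1 ≤ H.price G x W u ω} := by
      ext ω
      simp only [hB, mem_ofPred_eq, mem_inter_iff]
      constructor
      · exact fun h => ⟨fun i hi => h i (by omega), h (j + 1) le_rfl⟩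
      · rintro ⟨h1, h2⟩ i hi
        rcases Nat.le_succ_iff.1 hi with h | h
        · exact h1 i h
        · rw [h]; exact h2
    refine ⟨mXu, mZu, ?_, ?_⟩
    · rw [eB]
      exact (hFru _ mB).inter (measurableSet_le measurable_const mXu)
    · have step := lintegral_step_le P (F.le r) D (mD.mono (F.le u) le_rfl) (sub_nonneg.2 hl.le)
        (hW.increment_law r u (ht.trans hr.1) hl.le hu.2)
        (hW.increment_indep r u (ht.trans hr.1) hl.le hu.2)
        (z := B.indicator (G.discount W r)) (y := fun ω => H.price G x W r ω + 2)
        (mZ.indicator mB) (mX.add_const 2) mg mh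
        (fun ω => indicator_nonneg (fun _ _ => (Real.exp_pos _).le) ω)
        (fun ω => by
          by_cases hω : ω ∈ B
          · right
            linarith [hω j le_rfl]
          · left
            exact indicator_of_notMem hω _) hκ hκ1 (hv j hjn)
      refine ((lintegral_mono fun ω => ?_).trans (step.trans (mul_le_mul_right hI _))).trans_eq
        (by ring)
      rw [eB]
      by_cases hω : ω ∈ B ∩ {ω | -1 ≤ H.price G x W u ω}
      · rw [indicator_of_mem hω, indicator_of_mem hω.1, eX, eZ]
        refine ENNReal.ofReal_le_ofReal (le_of_eq ?_)
        ring
      · rw [indicator_of_notMem hω, zero_mul, ENNReal.ofReal_zero]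
        exact zero_le

/-- A finite set of times can be refined to a partition whose mesh is at most `(T - t) / N`, at
the cost of at most `N + 1` further points. -/
lemma _root_.exists_partition {t T : ℝ} (htT : t ≤ T) (A : Finset ℝ)
    (hA : ∀ a ∈ A, a ∈ Icc t T) {N : ℕ} (hN : 0 < N) :
    ∃ (n : ℕ) (π : ℕ → ℝ), n ≤ A.card + (N + 1) ∧ π 0 = t ∧ π n = T ∧ (∀ j ≤ n, π j ∈ Icc t T) ∧
      (∀ j < n, π j < π (j + 1)) ∧ (∀ j < n, π (j + 1) - π j ≤ (T - t) / N) ∧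
      ∀ j < n, ∀ a ∈ A, a ≤ π j ∨ π (j + 1) ≤ a := by
  classical
  have hN' : (0 : ℝ) < N := by exact_mod_cast hN
  have hT : 0 ≤ T - t := sub_nonneg.2 htT
  set q : ℕ → ℝ := fun i => t + i * ((T - t) / N) with hq
  have hq0 : q 0 = t := by simp [hq]
  have hqN : q N = T := by simp only [hq]; field_simp; ring
  set Q := A ∪ (Finset.range (N + 1)).image q with hQ
  have hqQ : ∀ i ≤ N, q i ∈ Q := fun i hi =>
    Finset.mem_union_right _ (Finset.mem_image_of_mem q (Finset.mem_range.2 (by omega)))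
  have hqmem : ∀ i ≤ N, q i ∈ Icc t T := by
    intro i hi
    have hi' : (i : ℝ) ≤ N := by exact_mod_cast hi
    have hd : 0 ≤ (T - t) / N := by positivity
    have h1 : 0 ≤ (i : ℝ) * ((T - t) / N) := by positivity
    have h2 : (i : ℝ) * ((T - t) / N) ≤ N * ((T - t) / N) := by gcongr
    have h3 : (N : ℝ) * ((T - t) / N) = T - t := by field_simp
    exact ⟨by simp only [hq]; linarith, by simp only [hq]; linarith⟩
  have hQmem : ∀ a ∈ Q, a ∈ Icc t T := by
    intro a ha
    rcases Finset.mem_union.1 ha with h | h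
    · exact hA a h
    · obtain ⟨i, hi, rfl⟩ := Finset.mem_image.1 h
      exact hqmem i (by have := Finset.mem_range.1 hi; omega)
  have hcard : Q.card ≤ A.card + (N + 1) := by
    refine (Finset.card_union_le _ _).trans (Nat.add_le_add_left ?_ _)
    exact Finset.card_image_le.trans (by simp)
  have hpos : 0 < Q.card := Finset.card_pos.2 ⟨_, hqQ 0 (Nat.zero_le _)⟩
  obtain ⟨n, hn⟩ : ∃ n, Q.card = n + 1 := ⟨Q.card - 1, by omega⟩
  set e := Q.orderEmbOfFin hn with he
  set π : ℕ → ℝ := fun j => e ⟨min j n, by omega⟩ with hπ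
  have hsurj : ∀ a ∈ Q, ∃ i ≤ n, π i = a := by
    intro a ha
    have : a ∈ Set.range e := by rw [he, Finset.range_orderEmbOfFin]; exact ha
    obtain ⟨i, rfl⟩ := this
    refine ⟨i, by omega, ?_⟩
    simp only [hπ]
    congr 1
    exact Fin.ext (min_eq_left (by omega))
  have hmono : Monotone π := fun i j hij => e.monotone (by
    simp only [Fin.mk_le_mk]; omega)
  have hπQ : ∀ j, π j ∈ Q := fun j => Finset.orderEmbOfFin_mem Q hn _
  have hgap : ∀ j < n, ∀ a ∈ Q, a ≤ π j ∨ π (j + 1) ≤ a := by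
    intro j _ a ha
    obtain ⟨i, _, rfl⟩ := hsurj a ha
    rcases Nat.lt_or_ge j i with h | h
    · exact Or.inr (hmono h)
    · exact Or.inl (hmono h)
  have hlt : ∀ j < n, π j < π (j + 1) := fun j hj => e.strictMono (by
    simp only [Fin.mk_lt_mk]; omega)
  refine ⟨n, π, by omega, ?_, ?_, fun j _ => hQmem _ (hπQ j), hlt, fun j hj => ?_,
    fun j hj a ha => hgap j hj a (Finset.mem_union_left _ ha)⟩
  · obtain ⟨i, _, hi⟩ := hsurj t (hq0 ▸ hqQ 0 (Nat.zero_le _))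
    exact le_antisymm (hi ▸ hmono (Nat.zero_le i)) (hQmem _ (hπQ 0)).1
  · obtain ⟨i, hin, hi⟩ := hsurj T (hqN ▸ hqQ N le_rfl)
    exact le_antisymm (hQmem _ (hπQ n)).2 (hi ▸ hmono hin)
  · -- the last grid point below `π j` and its successor enclose `π (j + 1)`
    have hex : ∃ i, i ≤ N ∧ π j < q i := ⟨N, le_rfl, by
      rw [hqN]; exact (hlt j hj).trans_le (hQmem _ (hπQ (j + 1))).2⟩
    have hi := Nat.find_spec hex
    set i := Nat.find hex with hidef
    have hi0 : i ≠ 0 := by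
      intro h0
      rw [h0, hq0] at hi
      exact absurd hi.2 (not_lt.2 (hQmem _ (hπQ j)).1)
    obtain ⟨i', hi'⟩ := Nat.exists_eq_succ_of_ne_zero hi0
    have hmin := Nat.find_min hex (m := i') (by omega)
    have h1 : q i' ≤ π j := by
      by_contra hcon
      exact hmin ⟨by omega, not_le.1 hcon⟩
    have h2 : π (j + 1) ≤ q i := by
      rcases hgap j hj (q i) (hqQ i hi.1) with h | h
      · exact absurd hi.2 (not_lt.2 h)
      · exact h
    have h3 : q i - q i' = (T - t) / N := by
      simp only [hq, hi']
      push_cast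
      ring
    linarith

/-- The discounted shifted price of a pair of simple processes, restricted to an event containing
every path on which the price stays above `-1`, has expectation bounded independently of the
processes. -/
lemma exists_lintegral_discount_mul_price_le {P : Measure Ω} [IsProbabilityMeasure P]
    {W : ℝ → Ω → Fin K → ℝ} (hW : IsBrownianMotionOn P F T W) (ht : t ∈ Icc 0 T)
    (H G : SimpleProcess F K t T) (x : ℝ) :
    Measurable (H.price G x W T) ∧ Measurable (G.discount W T) ∧
    ∃ B : Set Ω, MeasurableSet B ∧ (∀ ω, (∀ u ∈ Icc t T, -1 ≤ H.price G x W u ω) → ω ∈ B) ∧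
      ∫⁻ ω, ENNReal.ofReal (B.indicator (G.discount W T) ω * (H.price G x W T ω + 2)) ∂P ≤
        3 * ENNReal.ofReal (x + 2) := by
  classical
  obtain ⟨C, hC0, hC⟩ := H.exists_abs_eval_le
  set M : ℝ := K * C ^ 2 with hM
  have hM0 : 0 ≤ M := by positivity
  have hHM : ∀ u ω, ∑ k, H.eval u ω k ^ 2 ≤ M := by
    intro u ω
    refine (Finset.sum_le_card_nsmul _ _ (C ^ 2) fun k _ => ?_).trans (by simp [hM])
    rw [← sq_abs]
    gcongr
    exact hC u ω k
  set c : ℝ := M * (T - t) + 1 with hc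
  have hT : 0 ≤ T - t := sub_nonneg.2 ht.2
  have hc1 : 1 ≤ c := by have := mul_nonneg hM0 hT; linarith
  set A : Finset ℝ := (Finset.range (G.n + 1)).image G.time ∪
    (Finset.range (H.n + 1)).image H.time with hA
  have hAmem : ∀ a ∈ A, a ∈ Icc t T := by
    intro a ha
    rcases Finset.mem_union.1 ha with h | h
    · obtain ⟨i, _, rfl⟩ := Finset.mem_image.1 h
      exact G.time_mem i
    · obtain ⟨i, _, rfl⟩ := Finset.mem_image.1 h
      exact H.time_mem i
  -- with mesh `(T - t) / N` every step of `∫ H dW` has variance at most `c / N`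
  set N : ℕ := ⌈18 * c ^ 2⌉₊ + A.card + 1 with hN
  have hN1 : 18 * c ^ 2 ≤ N := by
    refine (Nat.le_ceil _).trans ?_
    exact_mod_cast (by omega : ⌈18 * c ^ 2⌉₊ ≤ N)
  have hN0 : (0 : ℝ) < N := by nlinarith
  obtain ⟨n, π, hn, h0, hnT, hmem, hlt, hmesh, hgap⟩ :=
    exists_partition ht.2 A hAmem (N := N) (by omega)
  have hκ : 0 < c / N := by positivity
  have hκ1 : c / N ≤ 1 := by rw [div_le_one hN0]; nlinarith
  have key := lintegral_killed_le hW ht.1 H G (x := x) hκ hκ1 h0 hmem hlt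
    (fun j hj i hi => hgap j hj _ (Finset.mem_union_left _
      (Finset.mem_image_of_mem _ (Finset.mem_range.2 (by omega)))))
    (fun j hj i hi => hgap j hj _ (Finset.mem_union_right _
      (Finset.mem_image_of_mem _ (Finset.mem_range.2 (by omega)))))
    (fun j hj ω => by
      calc (π (j + 1) - π j) * ∑ k, H.eval (π (j + 1)) ω k ^ 2
          ≤ (T - t) / N * M := by
            refine mul_le_mul (hmesh j hj) (hHM _ _) ?_ (by positivity)
            exact Finset.sum_nonneg fun k _ => sq_nonneg _
        _ = M * (T - t) / N := by ring
        _ ≤ c / N := by gcongr; linarith) n le_rfl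
  rw [hnT] at key
  obtain ⟨mX, mZ, mB, hI⟩ := key
  refine ⟨mX.mono (F.le T) le_rfl, mZ.mono (F.le T) le_rfl, _, F.le T _ mB,
    fun ω hω i hi => hω _ (hmem i hi), hI.trans ?_⟩
  gcongr
  -- the number of steps is at most `2 N`, so that the factors multiply up to at most `e`
  rw [← ENNReal.ofReal_pow (by positivity), ← ENNReal.ofReal_ofNat]
  refine ENNReal.ofReal_le_ofReal ?_
  have hn2 : (n : ℝ) ≤ 2 * N := by exact_mod_cast (by omega : n ≤ 2 * N)
  calc (1 + 9 * (c / N) ^ 2) ^ n ≤ Real.exp (9 * (c / N) ^ 2) ^ n := by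
        gcongr
        linarith [Real.add_one_le_exp (9 * (c / N) ^ 2)]
    _ = Real.exp (n * (9 * (c / N) ^ 2)) := (Real.exp_nat_mul _ _).symm
    _ ≤ Real.exp 1 := by
        refine Real.exp_le_exp.2 ?_
        calc (n : ℝ) * (9 * (c / N) ^ 2) ≤ 2 * N * (9 * (c / N) ^ 2) := by gcongr
          _ = 18 * c ^ 2 / N := by field_simp; ring
          _ ≤ 1 := (div_le_one hN0).2 hN1
    _ ≤ 3 := Real.exp_one_lt_three.le

end SimpleProcess

/-! ### Convergence of the approximations -/

/-- Convergence in probability at every scale holds almost surely along a subsequence. The events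
need not be measurable. -/
lemma exists_strictMono_ae_eventually_notMem {Ω : Type*} {mΩ : MeasurableSpace Ω} {P : Measure Ω}
    {A : ℝ → ℕ → Set Ω} (hA : ∀ ε, 0 < ε → Tendsto (fun m => P (A ε m)) atTop (𝓝 0)) :
    ∃ φ : ℕ → ℕ, StrictMono φ ∧ ∀ᵐ ω ∂P, ∀ᶠ k : ℕ in atTop, ω ∉ A (1 / ((k : ℝ) + 1)) (φ k) := by
  obtain ⟨φ, hφ, h⟩ := extraction_forall_of_eventually
    (P := fun k m => P (A (1 / ((k : ℝ) + 1)) m) ≤ (2⁻¹ : ENNReal) ^ k) fun k => by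
      have h1 : (0 : ENNReal) < 2⁻¹ ^ k :=
        ENNReal.pow_pos (ENNReal.inv_pos.2 ENNReal.ofNat_ne_top) k
      filter_upwards [(hA (1 / ((k : ℝ) + 1)) (by positivity)).eventually_lt_const h1] with m hm
      exact hm.le
  refine ⟨φ, hφ, ?_⟩
  have hsum : ∑' k : ℕ, P (A (1 / ((k : ℝ) + 1)) (φ k)) ≠ ⊤ := by
    refine ne_top_of_le_ne_top ?_ (ENNReal.tsum_le_tsum h)
    rw [ENNReal.tsum_geometric]
    simp
  have h0 := measure_setOfPred_frequently_eq_zero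
    (p := fun k ω => ω ∈ A (1 / ((k : ℝ) + 1)) (φ k)) hsum
  rw [ae_iff]
  refine measure_mono_null (fun ω hω => ?_) h0
  simpa [Filter.Frequently] using hω

lemma integrable_sum_sq_of_lintegral_ne_top {X : Type*} {mX : MeasurableSpace X} {ν : Measure X}
    {K : ℕ} {a : X → Fin K → ℝ} (ha : ∀ k, AEStronglyMeasurable (fun x => a x k) ν)
    (h : ∫⁻ x, ENNReal.ofReal (∑ k, a x k ^ 2) ∂ν ≠ ⊤) :
    Integrable (fun x => ∑ k, a x k ^ 2) ν := by
  have hm : AEStronglyMeasurable (fun x => ∑ k, a x k ^ 2) ν :=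
    Finset.aestronglyMeasurable_fun_sum _ fun k _ => (ha k).pow 2
  refine ⟨hm, ?_⟩
  rw [hasFiniteIntegral_iff_ofReal (ae_of_all _ fun x => Finset.sum_nonneg fun k _ => sq_nonneg _)]
  exact h.lt_top

lemma integrable_sum_mul_of_sq {X : Type*} {mX : MeasurableSpace X} {ν : Measure X} {K : ℕ}
    {a b : X → Fin K → ℝ} (ha : ∀ k, AEStronglyMeasurable (fun x => a x k) ν)
    (hb : ∀ k, AEStronglyMeasurable (fun x => b x k) ν)
    (ha2 : Integrable (fun x => ∑ k, a x k ^ 2) ν) (hb2 : Integrable (fun x => ∑ k, b x k ^ 2) ν) :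
    Integrable (fun x => ∑ k, a x k * b x k) ν := by
  refine (ha2.add hb2).mono' (Finset.aestronglyMeasurable_fun_sum _ fun k _ => (ha k).mul (hb k))
    (ae_of_all _ fun x => ?_)
  simp only [Pi.add_apply, Real.norm_eq_abs, ← Finset.sum_add_distrib]
  refine (Finset.abs_sum_le_sum_abs _ _).trans (Finset.sum_le_sum fun k _ => ?_)
  rw [abs_le]
  constructor <;> nlinarith [sq_nonneg (a x k + b x k), sq_nonneg (a x k - b x k)]

/-- If `a' m → a` and `b' m → b` in `L²`, the integrals of `a' m · b' m` converge to those of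
`a · b`, uniformly in the upper limit of integration. -/
lemma eventually_forall_abs_integral_sub_lt {K : ℕ} {t T : ℝ} {a b : ℝ → Fin K → ℝ}
    {a' b' : ℕ → ℝ → Fin K → ℝ}
    (ha : ∀ k, AEStronglyMeasurable (fun r => a r k) (volume.restrict (Icc t T)))
    (hb : ∀ k, AEStronglyMeasurable (fun r => b r k) (volume.restrict (Icc t T)))
    (ha' : ∀ m k, AEStronglyMeasurable (fun r => a' m r k) (volume.restrict (Icc t T)))
    (hb' : ∀ m k, AEStronglyMeasurable (fun r => b' m r k) (volume.restrict (Icc t T)))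
    (ha2 : ∀ m, Integrable (fun r => ∑ k, a' m r k ^ 2) (volume.restrict (Icc t T)))
    (hb2 : ∀ m, Integrable (fun r => ∑ k, b' m r k ^ 2) (volume.restrict (Icc t T)))
    (hac : Tendsto (fun m => ∫⁻ r in Icc t T, ENNReal.ofReal (∑ k, (a r k - a' m r k) ^ 2))
      atTop (𝓝 0))
    (hbc : Tendsto (fun m => ∫⁻ r in Icc t T, ENNReal.ofReal (∑ k, (b r k - b' m r k) ^ 2))
      atTop (𝓝 0)) {ε : ℝ} (hε : 0 < ε) :
    ∀ᶠ m in atTop, ∀ u ∈ Icc t T, |(∫ r in t..u, ∑ k, a' m r k * b' m r k) -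
      ∫ r in t..u, ∑ k, a r k * b r k| < ε := by
  set ν := volume.restrict (Icc t T) with hν
  have fin : ∀ {c : ℝ → Fin K → ℝ} {c' : ℕ → ℝ → Fin K → ℝ},
      (∀ k, AEStronglyMeasurable (fun r => c r k) ν) →
      (∀ m k, AEStronglyMeasurable (fun r => c' m r k) ν) →
      Tendsto (fun m => ∫⁻ r, ENNReal.ofReal (∑ k, (c r k - c' m r k) ^ 2) ∂ν) atTop (𝓝 0) →
      (∀ᶠ m in atTop, Integrable (fun r => ∑ k, (c r k - c' m r k) ^ 2) ν) ∧
      Tendsto (fun m => ∫ r, ∑ k, (c r k - c' m r k) ^ 2 ∂ν) atTop (𝓝 0) := by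
    intro c c' hc hc' hcc
    constructor
    · filter_upwards [hcc.eventually_lt_const ENNReal.zero_lt_top] with m hm
      exact integrable_sum_sq_of_lintegral_ne_top (a := fun r k => c r k - c' m r k)
        (fun k => (hc k).sub (hc' m k)) hm.ne
    · have h := (ENNReal.tendsto_toReal ENNReal.zero_ne_top).comp hcc
      rw [ENNReal.toReal_zero] at h
      refine h.congr fun m => ?_
      exact (integral_eq_lintegral_of_nonneg_ae
        (ae_of_all _ fun x => Finset.sum_nonneg fun k _ => sq_nonneg _)
        (Finset.aestronglyMeasurable_fun_sum _ fun k _ => ((hc k).sub (hc' m k)).pow 2)).symm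
  have sq : ∀ {c c' : ℝ → Fin K → ℝ}, (∀ k, AEStronglyMeasurable (fun r => c r k) ν) →
      Integrable (fun r => ∑ k, c' r k ^ 2) ν →
      Integrable (fun r => ∑ k, (c r k - c' r k) ^ 2) ν →
      Integrable (fun r => ∑ k, c r k ^ 2) ν := by
    intro c c' hc h1 h2
    refine ((h1.add h2).const_mul 2).mono'
      (Finset.aestronglyMeasurable_fun_sum _ fun k _ => (hc k).pow 2) (ae_of_all _ fun r => ?_)
    rw [Real.norm_of_nonneg (Finset.sum_nonneg fun k _ => sq_nonneg _)]
    simp only [Pi.add_apply, ← Finset.sum_add_distrib, Finset.mul_sum]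
    exact Finset.sum_le_sum fun k _ => by nlinarith [sq_nonneg (c r k - 2 * c' r k)]
  obtain ⟨fa, la⟩ := fin ha ha' hac
  obtain ⟨fb, lb⟩ := fin hb hb' hbc
  obtain ⟨m₀, hm₀a, hm₀b⟩ := (fa.and fb).exists
  have a2 := sq ha (ha2 m₀) hm₀a
  have b2 := sq hb (hb2 m₀) hm₀b
  set J : ℝ := (∫ r, ∑ k, a r k ^ 2 ∂ν) + ∫ r, ∑ k, b r k ^ 2 ∂ν with hJ
  have hJ0 : 0 ≤ J := add_nonneg
    (integral_nonneg fun r => Finset.sum_nonneg fun k _ => sq_nonneg _)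
    (integral_nonneg fun r => Finset.sum_nonneg fun k _ => sq_nonneg _)
  set η : ℝ := ε / (2 * (J + 1)) with hη
  have hη0 : 0 < η := by positivity
  have hηJ : η * J < ε / 2 := by
    rw [hη, div_mul_eq_mul_div, div_lt_div_iff₀ (by positivity) (by norm_num)]
    nlinarith
  have hlim := (la.add lb).const_mul (1 + 1 / η)
  rw [add_zero, mul_zero] at hlim
  filter_upwards [fa, fb, hlim.eventually_lt_const (half_pos hε)] with m fam fbm hm u hu
  have ab := integrable_sum_mul_of_sq ha hb a2 b2
  have ab' := integrable_sum_mul_of_sq (ha' m) (hb' m) (ha2 m) (hb2 m)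
  have hsub : Ioc t u ⊆ Icc t T := fun r hr => ⟨hr.1.le, hr.2.trans hu.2⟩
  have hle : volume.restrict (Ioc t u) ≤ ν := Measure.restrict_mono hsub le_rfl
  rw [intervalIntegral.integral_of_le hu.1, intervalIntegral.integral_of_le hu.1,
    ← integral_sub (ab'.mono_measure hle) (ab.mono_measure hle)]
  calc |∫ r in Ioc t u, ((∑ k, a' m r k * b' m r k) - ∑ k, a r k * b r k)|
      ≤ ∫ r in Ioc t u, |(∑ k, a' m r k * b' m r k) - ∑ k, a r k * b r k| :=
        abs_integral_le_integral_abs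
    _ ≤ ∫ r, |(∑ k, a' m r k * b' m r k) - ∑ k, a r k * b r k| ∂ν :=
        integral_mono_measure hle (ae_of_all _ fun r => abs_nonneg _) (ab'.sub ab).abs
    _ ≤ ∫ r, (η * ((∑ k, a r k ^ 2) + ∑ k, b r k ^ 2) + (1 + 1 / η) *
          ((∑ k, (a r k - a' m r k) ^ 2) + ∑ k, (b r k - b' m r k) ^ 2)) ∂ν := by
        refine integral_mono (ab'.sub ab).abs
          (((a2.add b2).const_mul _).add ((fam.add fbm).const_mul _)) fun r => ?_
        simp only [← Finset.sum_sub_distrib, ← Finset.sum_add_distrib, Finset.mul_sum]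
        refine (Finset.abs_sum_le_sum_abs _ _).trans (Finset.sum_le_sum fun k _ => ?_)
        have young : ∀ x y : ℝ, |x * y| ≤ η * y ^ 2 + 1 / η * x ^ 2 := by
          intro x y
          have e : η * y ^ 2 + 1 / η * x ^ 2 = (η * |y| - |x|) ^ 2 / η + 2 * |x * y| := by
            rw [abs_mul, ← sq_abs x, ← sq_abs y]
            field_simp
            ring
          have : 0 ≤ (η * |y| - |x|) ^ 2 / η := by positivity
          linarith [abs_nonneg (x * y)]
        have h1 := young (a r k - a' m r k) (b r k)
        have h2 := young (b r k - b' m r k) (a r k)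
        have h3 : |(a r k - a' m r k) * (b r k - b' m r k)| ≤
            (a r k - a' m r k) ^ 2 + (b r k - b' m r k) ^ 2 := by
          rw [abs_le]
          constructor <;>
            nlinarith [sq_nonneg ((a r k - a' m r k) + (b r k - b' m r k)),
              sq_nonneg ((a r k - a' m r k) - (b r k - b' m r k))]
        have e : a' m r k * b' m r k - a r k * b r k =
            -((a r k - a' m r k) * b r k) - (b r k - b' m r k) * a r k +
              (a r k - a' m r k) * (b r k - b' m r k) := by ring
        rw [e]
        rw [abs_le] at h1 h2 h3 ⊢
        constructor <;> linarith
    _ = η * J + (1 + 1 / η) * ((∫ r, ∑ k, (a r k - a' m r k) ^ 2 ∂ν) +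
          ∫ r, ∑ k, (b r k - b' m r k) ^ 2 ∂ν) := by
        have e1 : Integrable (fun r => η * ((∑ k, a r k ^ 2) + ∑ k, b r k ^ 2)) ν :=
          (a2.add b2).const_mul _
        have e2 : Integrable (fun r => (1 + 1 / η) *
            ((∑ k, (a r k - a' m r k) ^ 2) + ∑ k, (b r k - b' m r k) ^ 2)) ν :=
          (fam.add fbm).const_mul _
        rw [integral_add e1 e2, integral_const_mul, integral_const_mul, integral_add a2 b2,
          integral_add fam fbm]
    _ < ε := by linarith

namespace SimpleProcess

lemma integrable_sum_sq_eval {Ω : Type*} {mΩ : MeasurableSpace Ω} {F : Filtration ℝ mΩ} {K : ℕ}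
    {t T : ℝ} (htT : t ≤ T) (G : SimpleProcess F K t T) (ω : Ω) :
    Integrable (fun r => ∑ k, G.eval r ω k ^ 2) (volume.restrict (Icc t T)) := by
  have h := (intervalIntegrable_iff_integrableOn_Icc_of_le htT).1
    (intervalIntegrable_eval_mul_eval G G ω t T)
  simp only [pow_two]
  exact h

end SimpleProcess

/-! ### Integrability of the discounted stock price -/

/-- The product of the discount factor with a stock price is bounded in expectation: the pathwise
approximations by simple processes converge, and Fatou's lemma applies to the approximating
products, because the events to which they are restricted eventually contain almost every path. -/
lemma aemeasurable_and_lintegral_discount_mul_stock_lt_top {d K : ℕ} {Ω : Type*}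
    {mΩ : MeasurableSpace Ω} {P : Measure Ω} [IsProbabilityMeasure P] {F : Filtration ℝ mΩ} {T : ℝ}
    {W : ℝ → Ω → Fin K → ℝ} (hW : IsBrownianMotionOn P F T W)
    {μ : ℝ → (Fin d → ℝ) → Fin d → ℝ} {σ : ℝ → (Fin d → ℝ) → Matrix (Fin d) (Fin K) ℝ}
    (hσ : ∀ i k, Measurable (fun x : ℝ × (Fin d → ℝ) => σ x.1 x.2 i k))
    {t : ℝ} (ht : t ∈ Icc 0 T) {s : Fin d → ℝ} {S : ℝ → Ω → Fin d → ℝ}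
    (hS : IsStockPrice P F T W μ σ t s S) {θ : ℝ → (Fin d → ℝ) → Fin K → ℝ}
    (hθ : IsMarkovianMPR P T μ σ t S θ) {Z : ℝ → Ω → ℝ}
    (hZ : IsStochasticDiscountFactor P F T W t S θ Z) (i : Fin d) :
    AEMeasurable (Z T) P ∧ ∫⁻ ω, ENNReal.ofReal (Z T ω * (S T ω i + 2)) ∂P < ⊤ := by
  obtain ⟨X, ⟨H, hH1, hH2⟩, hX⟩ := hS.dynamics i
  obtain ⟨Y, ⟨G, hG1, hG2⟩, hY⟩ := hZ
  have hT : T ∈ Icc t T := ⟨ht.2, le_rfl⟩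
  obtain ⟨φ, -, hφ⟩ := exists_strictMono_ae_eventually_notMem (P := P)
    (A := fun ε m => ({ω | ENNReal.ofReal ε ≤ ∫⁻ u in Icc t T, ENNReal.ofReal
        (∑ k, (S u ω i * σ u (S u ω) i k - (H m).eval u ω k) ^ 2)} ∪
      {ω | ∃ u ∈ Icc t T, ε ≤ |(H m).integral W u ω - X u ω|}) ∪
      ({ω | ENNReal.ofReal ε ≤ ∫⁻ u in Icc t T, ENNReal.ofReal
        (∑ k, (θ u (S u ω) k - (G m).eval u ω k) ^ 2)} ∪
      {ω | ∃ u ∈ Icc t T, ε ≤ |(G m).integral W u ω - Y u ω|}))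
    (by
      intro ε hε
      have h := ((hH1 ε hε).add (hH2 ε hε)).add ((hG1 ε hε).add (hG2 ε hε))
      simp only [add_zero] at h
      refine tendsto_of_tendsto_of_tendsto_of_le_of_le tendsto_const_nhds h
        (fun m => zero_le) fun m => ?_
      exact (measure_union_le _ _).trans
        (add_le_add (measure_union_le _ _) (measure_union_le _ _)))
  have small : Tendsto (fun k : ℕ => 1 / ((k : ℝ) + 1)) atTop (𝓝 0) :=
    tendsto_one_div_add_atTop_nhds_zero_nat
  -- pathwise convergence of the discount factors and, uniformly, of the prices
  have conv : ∀ᵐ ω ∂P, Tendsto (fun m => (G (φ m)).discount W T ω) atTop (𝓝 (Z T ω)) ∧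
      ∀ ε, 0 < ε → ∀ᶠ m in atTop, ∀ u ∈ Icc t T,
        |(H (φ m)).price (G (φ m)) (s i) W u ω - S u ω i| < ε := by
    filter_upwards [hφ, hX, hY, hS.continuous, hθ.eq] with ω hω hXω hYω hc hμ
    simp only [mem_union, mem_ofPred_eq, not_or, not_exists, not_and, not_le] at hω
    have hSm : AEMeasurable (fun u => (u, S u ω)) (volume.restrict (Icc t T)) :=
      aemeasurable_id.prodMk (hc.aemeasurable measurableSet_Icc)
    have hb : ∀ k, AEStronglyMeasurable (fun r => θ r (S r ω) k) (volume.restrict (Icc t T)) :=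
      fun k => (((measurable_pi_apply k).comp hθ.measurable).comp_aemeasurable
        hSm).aestronglyMeasurable
    have ha : ∀ k, AEStronglyMeasurable (fun r => S r ω i * σ r (S r ω) i k)
        (volume.restrict (Icc t T)) := fun k =>
      (((measurable_pi_apply i).comp_aemeasurable (measurable_snd.comp_aemeasurable hSm)).mul
        ((hσ i k).comp_aemeasurable hSm)).aestronglyMeasurable
    have small' := ENNReal.tendsto_ofReal small
    rw [ENNReal.ofReal_zero] at small'
    have hac : Tendsto (fun m => ∫⁻ r in Icc t T, ENNReal.ofReal
        (∑ k, (S r ω i * σ r (S r ω) i k - (H (φ m)).eval r ω k) ^ 2)) atTop (𝓝 0) :=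
      tendsto_of_tendsto_of_tendsto_of_le_of_le' tendsto_const_nhds small'
        (Eventually.of_forall fun m => zero_le) (hω.mono fun m hm => hm.1.1.le)
    have hbc : Tendsto (fun m => ∫⁻ r in Icc t T, ENNReal.ofReal
        (∑ k, (θ r (S r ω) k - (G (φ m)).eval r ω k) ^ 2)) atTop (𝓝 0) :=
      tendsto_of_tendsto_of_tendsto_of_le_of_le' tendsto_const_nhds small'
        (Eventually.of_forall fun m => zero_le) (hω.mono fun m hm => hm.2.1.le)
    have mG : ∀ m k, AEStronglyMeasurable (fun r => (G (φ m)).eval r ω k)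
        (volume.restrict (Icc t T)) := fun m k =>
      ((G (φ m)).measurable_eval_time ω k).aestronglyMeasurable
    have mH : ∀ m k, AEStronglyMeasurable (fun r => (H (φ m)).eval r ω k)
        (volume.restrict (Icc t T)) := fun m k =>
      ((H (φ m)).measurable_eval_time ω k).aestronglyMeasurable
    have iG := fun m => (G (φ m)).integrable_sum_sq_eval ht.2 ω
    have iH := fun m => (H (φ m)).integrable_sum_sq_eval ht.2 ω
    constructor
    · have l1 : Tendsto (fun m => (G (φ m)).integral W T ω) atTop (𝓝 (Y T ω)) := by
        rw [tendsto_iff_dist_tendsto_zero]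
        refine tendsto_of_tendsto_of_tendsto_of_le_of_le' tendsto_const_nhds small
          (Eventually.of_forall fun m => dist_nonneg) (hω.mono fun m hm => ?_)
        exact (hm.2.2 T hT).le
      have l2 : Tendsto (fun m => ∫ r in t..T, ∑ k, (G (φ m)).eval r ω k * (G (φ m)).eval r ω k)
          atTop (𝓝 (∫ r in t..T, ∑ k, θ r (S r ω) k * θ r (S r ω) k)) := by
        rw [Metric.tendsto_nhds]
        intro ε hε
        exact (eventually_forall_abs_integral_sub_lt hb hb mG mG iG iG hbc hbc hε).mono
          fun m hm => hm T hT
      rw [hYω T hT]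
      simp only [pow_two]
      exact (Real.continuous_exp.tendsto _).comp (l1.neg.sub (l2.const_mul _))
    · intro ε hε
      filter_upwards [hω, small.eventually_lt_const (half_pos hε),
        eventually_forall_abs_integral_sub_lt ha hb mH mG iH iG hac hbc (half_pos hε)]
        with m h1 h2 h3 u hu
      have hdrift : ∫ r in t..u, S r ω i * μ r (S r ω) i =
          ∫ r in t..u, ∑ k, S r ω i * σ r (S r ω) i k * θ r (S r ω) k := by
        refine intervalIntegral.integral_congr fun r hr => ?_
        rw [uIcc_of_le hu.1] at hr
        simp only [hμ r ⟨hr.1, hr.2.trans hu.2⟩, Matrix.mulVec, dotProduct, Finset.mul_sum,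
          mul_assoc]
      rw [hXω u hu, hdrift]
      have h4 := h1.1.2 u hu
      have h5 := h3 u hu
      simp only [SimpleProcess.price]
      rw [abs_lt] at h4 h5 ⊢
      constructor <;> linarith
  choose mX mZ B mB hB hI using fun m =>
    SimpleProcess.exists_lintegral_discount_mul_price_le hW ht (H (φ m)) (G (φ m)) (s i)
  refine ⟨aemeasurable_of_tendsto_metrizable_ae atTop (fun m => (mZ m).aemeasurable)
    (conv.mono fun ω h => h.1), ?_⟩
  set U : ℕ → Ω → ENNReal := fun m ω => ENNReal.ofReal ((B m).indicator ((G (φ m)).discount W T) ω *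
    ((H (φ m)).price (G (φ m)) (s i) W T ω + 2)) with hU
  have mU : ∀ m, Measurable (U m) := fun m =>
    ENNReal.measurable_ofReal.comp (((mZ m).indicator (mB m)).mul ((mX m).add_const 2))
  have hlim : ∀ᵐ ω ∂P, Tendsto (fun m => U m ω) atTop
      (𝓝 (ENNReal.ofReal (Z T ω * (S T ω i + 2)))) := by
    filter_upwards [conv, hS.positive] with ω hω hpos
    have hXT : Tendsto (fun m => (H (φ m)).price (G (φ m)) (s i) W T ω) atTop (𝓝 (S T ω i)) := by
      rw [Metric.tendsto_nhds]
      intro ε hε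
      exact (hω.2 ε hε).mono fun m hm => hm T hT
    refine (ENNReal.tendsto_ofReal (hω.1.mul (hXT.add_const 2))).congr' ?_
    filter_upwards [hω.2 1 one_pos] with m hm
    have : ω ∈ B m := hB m ω fun u hu => by
      have h1 := (abs_lt.1 (hm u hu)).1
      have h2 := hpos u hu i
      linarith
    simp only [hU, indicator_of_mem this]
  calc ∫⁻ ω, ENNReal.ofReal (Z T ω * (S T ω i + 2)) ∂P
      = ∫⁻ ω, liminf (fun m => U m ω) atTop ∂P :=
        lintegral_congr_ae (hlim.mono fun ω h => h.liminf_eq.symm)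
    _ ≤ liminf (fun m => ∫⁻ ω, U m ω ∂P) atTop := lintegral_liminf_le mU
    _ ≤ 3 * ENNReal.ofReal (s i + 2) :=
        liminf_le_of_frequently_le' (Frequently.of_forall hI)
    _ < ⊤ := ENNReal.mul_lt_top ENNReal.ofNat_lt_top ENNReal.ofReal_lt_top

theorem mainTheorem6 {d K : ℕ} [NeZero d] {Ω : Type*} {mΩ : MeasurableSpace Ω}
    (P : Measure Ω) [IsProbabilityMeasure P] (F : Filtration ℝ mΩ) (T : ℝ)
    (W : ℝ → Ω → Fin K → ℝ) (hW : IsBrownianMotionOn P F T W)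
    (μ : ℝ → (Fin d → ℝ) → Fin d → ℝ) (σ : ℝ → (Fin d → ℝ) → Matrix (Fin d) (Fin K) ℝ)
    (hμ : ∀ i, Measurable (fun x : ℝ × (Fin d → ℝ) => μ x.1 x.2 i))
    (hσ : ∀ i k, Measurable (fun x : ℝ × (Fin d → ℝ) => σ x.1 x.2 i k))
    (t : ℝ) (ht : t ∈ Icc 0 T) (s : Fin d → ℝ) (hs : s ∈ positiveOrthant d)
    (S : ℝ → Ω → Fin d → ℝ) (hS : IsStockPrice P F T W μ σ t s S)
    (θ : ℝ → (Fin d → ℝ) → Fin K → ℝ) (hθ : IsMarkovianMPR P T μ σ t S θ)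
    (Z : ℝ → Ω → ℝ) (hZ : IsStochasticDiscountFactor P F T W t S θ Z)
    (L : ℝ) :
    Integrable (discountedPayoff T S Z (putPayoff d L)) P ∧
    Integrable (discountedPayoff T S Z (stockPayoff d)) P ∧
    Integrable (discountedPayoff T S Z (callPayoff d L)) P ∧
    Integrable (discountedPayoff T S Z (moneyPayoff d)) P ∧
    hedgingPrice P T S Z (putPayoff d L) + hedgingPrice P T S Z (stockPayoff d) =
      hedgingPrice P T S Z (callPayoff d L) + L * hedgingPrice P T S Z (moneyPayoff d) := by
  have hT : T ∈ Icc t T := ⟨ht.2, le_rfl⟩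
  obtain ⟨mZ, hfin⟩ := aemeasurable_and_lintegral_discount_mul_stock_lt_top hW hσ ht hS hθ hZ 0
  have mS : Measurable fun ω => S T ω 0 :=
    (measurable_pi_apply 0).comp ((hS.adapted T hT).mono (F.le T) le_rfl)
  have hZpos : ∀ᵐ ω ∂P, 0 < Z T ω := by
    obtain ⟨I, -, hI⟩ := hZ
    filter_upwards [hI] with ω h
    rw [h T hT]
    exact Real.exp_pos _
  have hSpos : ∀ᵐ ω ∂P, 0 < S T ω 0 := by
    filter_upwards [hS.positive] with ω h
    exact h T hT 0
  have hint : Integrable (fun ω => Z T ω * (S T ω 0 + 2)) P := by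
    refine ⟨(mZ.mul (mS.add_const 2).aemeasurable).aestronglyMeasurable, ?_⟩
    rwa [hasFiniteIntegral_iff_ofReal]
    filter_upwards [hZpos, hSpos] with ω h1 h2
    exact mul_nonneg h1.le (by linarith)
  -- every payoff of at most linear growth is dominated by a multiple of `s ↦ s 0 + 2`
  have dom : ∀ (C : ℝ) (p : (Fin d → ℝ) → ℝ), Measurable p →
      (∀ x : Fin d → ℝ, 0 < x 0 → |p x| ≤ C * (x 0 + 2)) →
      Integrable (discountedPayoff T S Z p) P := by
    intro C p hp hC
    refine (hint.const_mul C).mono' (mZ.mul (hp.comp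
      ((hS.adapted T hT).mono (F.le T) le_rfl)).aemeasurable).aestronglyMeasurable ?_
    filter_upwards [hZpos, hSpos] with ω h1 h2
    have := mul_le_mul_of_nonneg_left (hC (S T ω) h2) h1.le
    rw [discountedPayoff, Real.norm_eq_abs, abs_mul, abs_of_pos h1]
    linarith
  have i1 : Integrable (discountedPayoff T S Z (putPayoff d L)) P := by
    refine dom |L| _ ((measurable_const.sub (measurable_pi_apply 0)).max measurable_const)
      fun x hx => ?_
    have := mul_nonneg (abs_nonneg L) hx.le
    rw [putPayoff, abs_of_nonneg (le_max_right _ _)]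
    exact max_le (by linarith [le_abs_self L, abs_nonneg L]) (by linarith [abs_nonneg L])
  have i2 : Integrable (discountedPayoff T S Z (stockPayoff d)) P := by
    refine dom 1 _ (measurable_pi_apply 0) fun x hx => ?_
    rw [stockPayoff, abs_of_pos hx]
    linarith
  have i3 : Integrable (discountedPayoff T S Z (callPayoff d L)) P := by
    refine dom (1 + |L|) _ (((measurable_pi_apply 0).sub measurable_const).max measurable_const)
      fun x hx => ?_
    have := mul_nonneg (abs_nonneg L) hx.le
    rw [callPayoff, abs_of_nonneg (le_max_right _ _)]
    exact max_le (by linarith [neg_abs_le L, abs_nonneg L]) (by linarith [abs_nonneg L])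
  have i4 : Integrable (discountedPayoff T S Z (moneyPayoff d)) P := by
    refine dom 1 _ measurable_const fun x hx => ?_
    rw [moneyPayoff, abs_one]
    linarith
  refine ⟨i1, i2, i3, i4, ?_⟩
  simp only [hedgingPrice]
  rw [← integral_add i1 i2, ← integral_const_mul, ← integral_add i3 (i4.const_mul L)]
  refine integral_congr_ae (ae_of_all _ fun ω => ?_)
  simp only [discountedPayoff, putPayoff, stockPayoff, callPayoff, moneyPayoff]
  rcases le_total (S T ω 0) L with h | h
  · rw [max_eq_left (sub_nonneg.2 h), max_eq_right (sub_nonpos.2 h)]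
    ring
  · rw [max_eq_right (sub_nonpos.2 h), max_eq_left (sub_nonneg.2 h)]
    ring
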